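/- Let $\alpha(s)=(x(s),y(s))$ be a smooth closed plane curve of length $\ell$ (not necessarily simple), parametrized by arc length, let $\omega,a,\Lambda_0\in\mathbb R$, $h>0$, and let $\Sigma$ be the immersed annulus $$\phi(s,t)=\bigl(x(s)\cos\omega t+y(s)\sin\omega t,\;-x(s)\sin\omega t+y(s)\cos\omega t,\;t\bigr),\qquad s\in\mathbb R/\ell\mathbb Z,\quad t\in[-h/2,h/2],$$ denoted $\alpha\times[-h/2,h/2]$, with unit normal $\nu=\phi_s\times\phi_t/|\phi_s\times\phi_t|$ and mean curvature $H$ (half the trace of the second fundamental form with respect to $\nu$; it depends only on $s$). Put $R^2=x_1^2+x_2^2$ and, for an oriented immersed surface $S\subset\mathbb R^3$ with unit normal $\nu$, $$\mathcal V(S)=\int_S \tfrac12(x_1,x_2,0)\cdot\nu\,dS,\qquad \mathcal E_{a,\Lambda_0}(S)=\mathrm{Area}(S)-\tfrac a2\int_S\tfrac{R^2}{4}(x_1,x_2,0)\cdot\nu\,dS+\Lambda_0\,\mathcal V(S).$$ Assume that the helicoidal surface is in equilibrium, that is, $2H=\Lambda_0-\tfrac a2R^2$. Call $\Sigma$ stable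 (for fixed boundary and fixed volume) if $\frac{d^2}{d\varepsilon^2}\big|_{\varepsilon=0}\mathcal E_{a,\Lambda_0}(X_\varepsilon)\ge 0$ for every smooth variation $X_\varepsilon$ of $\Sigma$ which fixes $\partial\Sigma$ and satisfies $\int_\Sigma\psi\,d\Sigma=0$, where $\psi=\partial_\varepsilon X_\varepsilon|_{\varepsilon=0}\cdot\nu$. Write $\xi_1=xx'+yy'$, and let $\mathcal A=\frac12\oint_\alpha(x\,dy-y\,dx)$ be the algebraic area enclosed by $\alpha$. If $\Sigma$ is stable, then $$\frac{2\pi^2}{h^2}\int_\alpha\frac{ds}{\sqrt{1+\omega^2\xi_1^2}}\;\ge\;\int_\alpha 2H^2\sqrt{1+\omega^2\xi_1^2}\,ds+a\,\mathcal A .$$ Moreover, this inequality is equivalent to $$\frac{2\pi^2}{h}\int_\alpha\frac{ds}{\sqrt{1+\omega^2\xi_1^2}}\;\ge\;\int_{\alpha\times[-h/2,h/2]}2H^2\,d\Sigma+a\,\mathcal V(\alpha\times[-h/2,h/2]).$$ -/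

import Mathlib

open scoped Matrix

noncomputable section

namespace HelicoidalDrop

/-! Parametrized surfaces `X : (s, t) ↦ X s t` in `ℝ³`. Vectors are elements of `Fin 3 → ℝ`; lengths
and angles are always taken with the dot product `⬝ᵥ`. -/

/-- The partial derivative `X_s`. -/
def dS (X : ℝ → ℝ → Fin 3 → ℝ) : ℝ → ℝ → Fin 3 → ℝ :=
  fun s t => deriv (fun u => X u t) s

/-- The partial derivative `X_t`. -/
def dT (X : ℝ → ℝ → Fin 3 → ℝ) : ℝ → ℝ → Fin 3 → ℝ :=
  fun s t => deriv (fun u => X s u) t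

/-- The area density: `dΣ = |X_s × X_t| ds dt`. -/
def areaDensity (X : ℝ → ℝ → Fin 3 → ℝ) (s t : ℝ) : ℝ :=
  √((dS X s t ⨯₃ dT X s t) ⬝ᵥ (dS X s t ⨯₃ dT X s t))

/-- The unit normal `ν = X_s × X_t / |X_s × X_t|`. -/
def unitNormal (X : ℝ → ℝ → Fin 3 → ℝ) (s t : ℝ) : Fin 3 → ℝ :=
  (areaDensity X s t)⁻¹ • (dS X s t ⨯₃ dT X s t)

/-- The mean curvature `H = (e G - 2 f F + g E) / (2 (E G - F²))` with respect to `ν`, where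
`E, F, G` and `e, f, g` are the coefficients of the first and the second fundamental form. -/
def meanCurvature (X : ℝ → ℝ → Fin 3 → ℝ) (s t : ℝ) : ℝ :=
  let E := dS X s t ⬝ᵥ dS X s t
  let F := dS X s t ⬝ᵥ dT X s t
  let G := dT X s t ⬝ᵥ dT X s t
  let e := dS (dS X) s t ⬝ᵥ unitNormal X s t
  let f := dS (dT X) s t ⬝ᵥ unitNormal X s t
  let g := dT (dT X) s t ⬝ᵥ unitNormal X s t
  (e * G - 2 * f * F + g * E) / (2 * (E * G - F ^ 2))

/-- The squared distance `R²` to the vertical axis. -/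
def axisDistSq (p : Fin 3 → ℝ) : ℝ := p 0 ^ 2 + p 1 ^ 2

/-- The vector field `W₀ = (1/2)(x₁, x₂, 0)`, of divergence `1`. -/
def fieldW₀ (p : Fin 3 → ℝ) : Fin 3 → ℝ := ![p 0 / 2, p 1 / 2, 0]

/-- The vector field `W = (R²/4)(x₁, x₂, 0)`, of divergence `R²`. -/
def fieldW (p : Fin 3 → ℝ) : Fin 3 → ℝ :=
  ![axisDistSq p / 4 * p 0, axisDistSq p / 4 * p 1, 0]

/-- `∫_Σ u dΣ` over the piece `0 ≤ s ≤ ℓ`, `-h/2 ≤ t ≤ h/2` of the surface `X`. -/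
def surfaceIntegral (ℓ h : ℝ) (X : ℝ → ℝ → Fin 3 → ℝ) (u : ℝ → ℝ → ℝ) : ℝ :=
  ∫ s in (0 : ℝ)..ℓ, ∫ t in (-(h / 2))..(h / 2), u s t * areaDensity X s t

/-- The surface area of the piece. -/
def surfaceArea (ℓ h : ℝ) (X : ℝ → ℝ → Fin 3 → ℝ) : ℝ :=
  surfaceIntegral ℓ h X fun _ _ => 1

/-- The (algebraic) volume `∫_Σ W₀ · ν dΣ`. -/
def volume (ℓ h : ℝ) (X : ℝ → ℝ → Fin 3 → ℝ) : ℝ :=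
  surfaceIntegral ℓ h X fun s t => fieldW₀ (X s t) ⬝ᵥ unitNormal X s t

/-- The (algebraic) moment of inertia `∫_U R² dv := ∫_Σ W · ν dΣ`. -/
def inertia (ℓ h : ℝ) (X : ℝ → ℝ → Fin 3 → ℝ) : ℝ :=
  surfaceIntegral ℓ h X fun s t => fieldW (X s t) ⬝ᵥ unitNormal X s t

/-- The energy: surface area `- (a/2) ∫_U R² dv + Λ₀ ·` volume. -/
def energy (a Λ₀ ℓ h : ℝ) (X : ℝ → ℝ → Fin 3 → ℝ) : ℝ :=
  surfaceArea ℓ h X - a / 2 * inertia ℓ h X + Λ₀ * volume ℓ h X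

/-- The equilibrium equation `2H = Λ₀ - (a/2) R²`. -/
def IsEquilibrium (a Λ₀ : ℝ) (X : ℝ → ℝ → Fin 3 → ℝ) : Prop :=
  ∀ s t, 2 * meanCurvature X s t = Λ₀ - a / 2 * axisDistSq (X s t)

/-- `Y ε` is a smooth variation, with fixed boundary, of the annular piece of the surface `X` given
by `s ∈ ℝ/ℓℤ`, `t ∈ [-h/2, h/2]`. -/
structure IsVariation (ℓ h : ℝ) (X : ℝ → ℝ → Fin 3 → ℝ)
    (Y : ℝ → ℝ → ℝ → Fin 3 → ℝ) : Prop where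
  smooth : ContDiff ℝ (⊤ : ℕ∞) fun p : ℝ × ℝ × ℝ => Y p.1 p.2.1 p.2.2
  periodic : ∀ ε s t, Y ε (s + ℓ) t = Y ε s t
  start : ∀ s, ∀ t ∈ Set.Icc (-(h / 2)) (h / 2), Y 0 s t = X s t
  fixed_bot : ∀ ε s, Y ε s (-(h / 2)) = X s (-(h / 2))
  fixed_top : ∀ ε s, Y ε s (h / 2) = X s (h / 2)

/-- The normal component `ψ = δX · ν` of a variation, where `δX = ∂Y/∂ε` at `ε = 0`. -/
def normalComponent (X : ℝ → ℝ → Fin 3 → ℝ) (Y : ℝ → ℝ → ℝ → Fin 3 → ℝ) (s t : ℝ) : ℝ :=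
  deriv (fun ε => Y ε s t) 0 ⬝ᵥ unitNormal X s t

/-- Stability of the annular piece `s ∈ ℝ/ℓℤ`, `t ∈ [-h/2, h/2]` of `X`, for fixed boundary and fixed
volume: the second variation of the energy is nonnegative for every variation which fixes the
boundary and satisfies `∫_Σ ψ dΣ = 0`. -/
def IsStable (a Λ₀ ℓ h : ℝ) (X : ℝ → ℝ → Fin 3 → ℝ) : Prop :=
  ∀ Y : ℝ → ℝ → ℝ → Fin 3 → ℝ, IsVariation ℓ h X Y →
    surfaceIntegral ℓ h X (normalComponent X Y) = 0 →
    0 ≤ iteratedDeriv 2 (fun ε => energy a Λ₀ ℓ h (Y ε)) 0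

/-- `α = (x, y)` is a smooth closed plane curve of length `ℓ`, parametrized by arc length. -/
structure IsClosedCurve (x y : ℝ → ℝ) (ℓ : ℝ) : Prop where
  length_pos : 0 < ℓ
  smooth_x : ContDiff ℝ (⊤ : ℕ∞) x
  smooth_y : ContDiff ℝ (⊤ : ℕ∞) y
  periodic_x : ∀ s, x (s + ℓ) = x s
  periodic_y : ∀ s, y (s + ℓ) = y s
  arc_length : ∀ s, deriv x s ^ 2 + deriv y s ^ 2 = 1

/-- The helicoidal immersion with profile curve `(x, y)`. -/
def helicoidal (ω : ℝ) (x y : ℝ → ℝ) : ℝ → ℝ → Fin 3 → ℝ := fun s t =>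
  ![x s * Real.cos (ω * t) + y s * Real.sin (ω * t),
    -x s * Real.sin (ω * t) + y s * Real.cos (ω * t),
    t]

/-- The TreadmillSled coordinate `ξ₁ = x cos θ + y sin θ`, where `(x', y') = (cos θ, sin θ)`. -/
def xi₁ (x y : ℝ → ℝ) (s : ℝ) : ℝ := x s * deriv x s + y s * deriv y s

/-- The (algebraic) area `(1/2) ∮ (x dy - y dx)` enclosed by the closed curve `(x, y)`. -/
def enclosedArea (x y : ℝ → ℝ) (ℓ : ℝ) : ℝ :=
  1 / 2 * ∫ s in (0 : ℝ)..ℓ, (x s * deriv y s - y s * deriv x s)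

/-- The bound on the height in terms of the profile curve and the area enclosed by it. Since `H`
does not depend on `t`, it is evaluated on the slice `t = 0`. -/
def AreaBound (a ω ℓ h : ℝ) (x y : ℝ → ℝ) : Prop :=
  2 * Real.pi ^ 2 / h ^ 2 * (∫ s in (0 : ℝ)..ℓ, 1 / √(1 + ω ^ 2 * xi₁ x y s ^ 2)) ≥
    (∫ s in (0 : ℝ)..ℓ,
      2 * meanCurvature (helicoidal ω x y) s 0 ^ 2 * √(1 + ω ^ 2 * xi₁ x y s ^ 2)) +
    a * enclosedArea x y ℓ

/-- The same bound in terms of the surface and the volume. -/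
def VolumeBound (a ω ℓ h : ℝ) (x y : ℝ → ℝ) : Prop :=
  2 * Real.pi ^ 2 / h * (∫ s in (0 : ℝ)..ℓ, 1 / √(1 + ω ^ 2 * xi₁ x y s ^ 2)) ≥
    surfaceIntegral ℓ h (helicoidal ω x y)
      (fun s t => 2 * meanCurvature (helicoidal ω x y) s t ^ 2) +
    a * volume ℓ h (helicoidal ω x y)

end HelicoidalDrop

end

open HelicoidalDrop

noncomputable section

namespace HelicoidalDrop

/-! Stability is tested on a single variation, with normal component `ψ = sin (k t)`, `k = 2π/h`,
which vanishes on the boundary and has mean zero. Put `W = √(1 + ω² ξ₁²)`, the area density, and `η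
= x y' - y x'`. Each horizontal slice is moved in its own plane by `ε W sin (k t)` along the normal
`(y', -x')` of the profile; the factor `W` compensates for the tilt of `ν`. The result is again a
`twisted` surface, so by `energy_twisted` its energy density is explicit: the square root of a
polynomial in `ε` plus another polynomial in `ε`. The second derivative can then be taken under the
integral.

Integrating over a full period in `t` leaves `h/2 ∮ (k²/W + variationCoeff) ds`. The key point is
`exists_primitive_variationCoeff`: in equilibrium, `variationCoeff` equals `-(4H²W + a η)` up to the
derivative of a periodic function. Invariantly, the second variation has density `|∇ψ|² - (4H² -
2K)ψ² - a η ψ²/W`, and the Gauss curvature `K` integrates to zero around the closed profile. Since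
`∮ η ds = 2𝒜`, the second variation is `h/2 (k² ∮ 1/W - 2 (∮ 2H²W + a𝒜))`, and its nonnegativity is
the claim. -/

open Set Filter Topology

/-! ### Differentiation under a double integral. -/

/-- Differentiation under a double integral, for an integrand which is continuously differentiable
in the parameter near the domain of integration. -/
theorem hasDerivAt_integral_integral {F F' : ℝ → ℝ → ℝ → ℝ} {U : Set (ℝ × ℝ × ℝ)} (hU : IsOpen U)
    {a b c d ε₀ : ℝ} (hab : a ≤ b) (hcd : c ≤ d)
    (hF : ContinuousOn (fun z : ℝ × ℝ × ℝ => F z.1 z.2.1 z.2.2) U)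
    (hF' : ContinuousOn (fun z : ℝ × ℝ × ℝ => F' z.1 z.2.1 z.2.2) U)
    (hderiv : ∀ z ∈ U, HasDerivAt (fun ε => F ε z.2.1 z.2.2) (F' z.1 z.2.1 z.2.2) z.1)
    (hK : ∀ p ∈ Icc a b ×ˢ Icc c d, (ε₀, p) ∈ U) :
    HasDerivAt (fun ε => ∫ s in a..b, ∫ t in c..d, F ε s t)
      (∫ s in a..b, ∫ t in c..d, F' ε₀ s t) ε₀ := by
  set K : Set (ℝ × ℝ) := Icc a b ×ˢ Icc c d with hKdef
  have hKc : IsCompact K := isCompact_Icc.prod isCompact_Icc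
  have hev : ∀ᶠ ε in 𝓝 ε₀, ∀ p ∈ K, (ε, p) ∈ U :=
    hKc.eventually_forall_of_forall_eventually fun p hp => hU.mem_nhds (hK p hp)
  have slice : ∀ {G : ℝ → ℝ → ℝ → ℝ} {ε : ℝ},
      ContinuousOn (fun z : ℝ × ℝ × ℝ => G z.1 z.2.1 z.2.2) U → (∀ p ∈ K, (ε, p) ∈ U) →
      ContinuousOn (fun p : ℝ × ℝ => G ε p.1 p.2) K := fun {G ε} hG hε =>
    hG.comp (f := fun p : ℝ × ℝ => (ε, p)) (by fun_prop) hε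
  have iter : ∀ G : ℝ × ℝ → ℝ, ContinuousOn G K →
      ∫ s in a..b, ∫ t in c..d, G (s, t) = ∫ p in K, G p := by
    intro G hG
    rw [hKdef, MeasureTheory.Measure.volume_eq_prod, MeasureTheory.setIntegral_prod _
      (by rw [← MeasureTheory.Measure.volume_eq_prod]; exact hG.integrableOn_compact hKc)]
    simp only [intervalIntegral.integral_of_le hab, intervalIntegral.integral_of_le hcd,
      MeasureTheory.integral_Icc_eq_integral_Ioc]
  -- Compactness of `K` gives a closed tube around `{ε₀} × K` inside `U`; there the derivative is
  -- bounded by a constant, which serves as the dominating function.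
  obtain ⟨δ, hδ, hδU⟩ := Metric.nhds_basis_closedBall.eventually_iff.1 hev
  have hBK : Metric.closedBall ε₀ δ ×ˢ K ⊆ U := fun z hz => hδU hz.1 z.2 hz.2
  obtain ⟨M, hM⟩ := ((isCompact_closedBall ε₀ δ).prod hKc).exists_bound_of_continuousOn
    (hF'.mono hBK)
  have hmem : ∀ᵐ p ∂((MeasureTheory.volume : MeasureTheory.Measure (ℝ × ℝ)).restrict K), p ∈ K :=
    MeasureTheory.ae_restrict_mem hKc.measurableSet
  have key := (hasDerivAt_integral_of_dominated_loc_of_deriv_le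
    (μ := (MeasureTheory.volume : MeasureTheory.Measure (ℝ × ℝ)).restrict K)
    (F := fun ε p => F ε p.1 p.2) (F' := fun ε p => F' ε p.1 p.2) (bound := fun _ => M)
    (Metric.closedBall_mem_nhds ε₀ hδ)
    (hev.mono fun ε hε => (slice hF hε).aestronglyMeasurable hKc.measurableSet)
    ((slice hF hK).integrableOn_compact hKc)
    ((slice hF' hK).aestronglyMeasurable hKc.measurableSet)
    (hmem.mono fun p hp ε hε => hM (ε, p) ⟨hε, hp⟩)
    (continuousOn_const.integrableOn_compact hKc)
    (hmem.mono fun p hp ε hε => hderiv (ε, p) (hBK ⟨hε, hp⟩))).2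
  have hval := iter (fun p => F' ε₀ p.1 p.2) (slice hF' hK)
  simp only at hval
  rw [hval]
  refine key.congr_of_eventuallyEq (hev.mono fun ε hε => ?_)
  exact iter (fun p => F ε p.1 p.2) (slice hF hε)

/-- The second derivative at `0` of a double integral whose integrand is continuous and twice
continuously differentiable in the parameter near the domain of integration. -/
theorem iteratedDeriv_two_integral_integral {F F' F'' : ℝ → ℝ → ℝ → ℝ} {U : Set (ℝ × ℝ × ℝ)}
    (hU : IsOpen U) {a b c d : ℝ} (hab : a ≤ b) (hcd : c ≤ d)
    (hF : ContinuousOn (fun z : ℝ × ℝ × ℝ => F z.1 z.2.1 z.2.2) U)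
    (hF' : ContinuousOn (fun z : ℝ × ℝ × ℝ => F' z.1 z.2.1 z.2.2) U)
    (hF'' : ContinuousOn (fun z : ℝ × ℝ × ℝ => F'' z.1 z.2.1 z.2.2) U)
    (hderiv : ∀ z ∈ U, HasDerivAt (fun ε => F ε z.2.1 z.2.2) (F' z.1 z.2.1 z.2.2) z.1)
    (hderiv' : ∀ z ∈ U, HasDerivAt (fun ε => F' ε z.2.1 z.2.2) (F'' z.1 z.2.1 z.2.2) z.1)
    (hK : ∀ p ∈ Icc a b ×ˢ Icc c d, ((0 : ℝ), p) ∈ U) :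
    iteratedDeriv 2 (fun ε => ∫ s in a..b, ∫ t in c..d, F ε s t) 0 =
      ∫ s in a..b, ∫ t in c..d, F'' 0 s t := by
  have hev : ∀ᶠ ε in 𝓝 (0 : ℝ), ∀ p ∈ Icc a b ×ˢ Icc c d, (ε, p) ∈ U :=
    (isCompact_Icc.prod isCompact_Icc).eventually_forall_of_forall_eventually
      fun p hp => hU.mem_nhds (hK p hp)
  rw [iteratedDeriv_succ, iteratedDeriv_one]
  have h1 : deriv (fun ε => ∫ s in a..b, ∫ t in c..d, F ε s t) =ᶠ[𝓝 0]
      fun ε => ∫ s in a..b, ∫ t in c..d, F' ε s t :=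
    hev.mono fun ε hε => (hasDerivAt_integral_integral hU hab hcd hF hF' hderiv hε).deriv
  rw [h1.deriv_eq]
  exact (hasDerivAt_integral_integral hU hab hcd hF' hF'' hderiv' hK).deriv

/-- The second derivative at `0` of a double integral of a Lagrangian of the form occurring for the
area of a twisted surface, plus a polynomial. -/
theorem iteratedDeriv_two_integral_sqrt_add {f g c₀ c₁ c₂ m₀ m₁ m₂ m₃ m₄ : ℝ → ℝ → ℝ}
    (hf : Continuous f.uncurry) (hg : Continuous g.uncurry) (hc₀ : Continuous c₀.uncurry)
    (hc₁ : Continuous c₁.uncurry) (hc₂ : Continuous c₂.uncurry) (hm₀ : Continuous m₀.uncurry)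
    (hm₁ : Continuous m₁.uncurry) (hm₂ : Continuous m₂.uncurry) (hm₃ : Continuous m₃.uncurry)
    (hm₄ : Continuous m₄.uncurry) {a b c d : ℝ} (hab : a ≤ b) (hcd : c ≤ d) :
    iteratedDeriv 2 (fun ε => ∫ s in a..b, ∫ t in c..d,
      (√((1 + ε * f s t) ^ 2 + (ε * g s t) ^ 2 + (c₀ s t + ε * c₁ s t + ε ^ 2 * c₂ s t) ^ 2) +
        (m₀ s t + ε * m₁ s t + ε ^ 2 * m₂ s t + ε ^ 3 * m₃ s t + ε ^ 4 * m₄ s t))) 0 =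
    ∫ s in a..b, ∫ t in c..d,
      ((f s t ^ 2 + g s t ^ 2 + c₁ s t ^ 2 + 2 * c₀ s t * c₂ s t) / √(1 + c₀ s t ^ 2) -
        (f s t + c₀ s t * c₁ s t) ^ 2 / √(1 + c₀ s t ^ 2) ^ 3 + 2 * m₂ s t) := by
  have lift : ∀ {k : ℝ → ℝ → ℝ}, Continuous k.uncurry →
      Continuous fun z : ℝ × ℝ × ℝ => k z.2.1 z.2.2 := fun hk => hk.comp continuous_snd
  have hf := lift hf
  have hg := lift hg
  have hc₀ := lift hc₀
  have hc₁ := lift hc₁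
  have hc₂ := lift hc₂
  have hm₀ := lift hm₀
  have hm₁ := lift hm₁
  have hm₂ := lift hm₂
  have hm₃ := lift hm₃
  have hm₄ := lift hm₄
  let P : ℝ → ℝ → ℝ → ℝ := fun ε s t =>
    (1 + ε * f s t) ^ 2 + (ε * g s t) ^ 2 + (c₀ s t + ε * c₁ s t + ε ^ 2 * c₂ s t) ^ 2
  let P' : ℝ → ℝ → ℝ → ℝ := fun ε s t =>
    2 * ((1 + ε * f s t) * f s t + ε * g s t ^ 2 +
      (c₀ s t + ε * c₁ s t + ε ^ 2 * c₂ s t) * (c₁ s t + 2 * ε * c₂ s t))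
  let P'' : ℝ → ℝ → ℝ → ℝ := fun ε s t =>
    2 * (f s t ^ 2 + g s t ^ 2 + (c₁ s t + 2 * ε * c₂ s t) ^ 2 +
      (c₀ s t + ε * c₁ s t + ε ^ 2 * c₂ s t) * (2 * c₂ s t))
  have hP : Continuous fun z : ℝ × ℝ × ℝ => P z.1 z.2.1 z.2.2 := by simp only [P]; fun_prop
  have hP' : Continuous fun z : ℝ × ℝ × ℝ => P' z.1 z.2.1 z.2.2 := by simp only [P']; fun_prop
  have hP'' : Continuous fun z : ℝ × ℝ × ℝ => P'' z.1 z.2.1 z.2.2 := by simp only [P'']; fun_prop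
  have dP : ∀ ε s t, HasDerivAt (fun ε => P ε s t) (P' ε s t) ε := by
    intro ε s t
    have h0 := hasDerivAt_id' ε
    have := ((((h0.mul_const (f s t)).const_add 1).pow 2).add ((h0.mul_const (g s t)).pow 2)).add
      ((((h0.mul_const (c₁ s t)).const_add (c₀ s t)).add ((h0.pow 2).mul_const (c₂ s t))).pow 2)
    refine this.congr_deriv ?_
    simp [P']; ring
  have dP' : ∀ ε s t, HasDerivAt (fun ε => P' ε s t) (P'' ε s t) ε := by
    intro ε s t
    have h0 := hasDerivAt_id' ε
    have := ((((h0.mul_const (f s t)).const_add 1).mul_const (f s t)).add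
      (h0.mul_const (g s t ^ 2))).add
      ((((h0.mul_const (c₁ s t)).const_add (c₀ s t)).add ((h0.pow 2).mul_const (c₂ s t))).mul
        (((h0.const_mul 2).mul_const (c₂ s t)).const_add (c₁ s t))) |>.const_mul 2
    refine this.congr_deriv ?_
    simp [P'']; ring
  -- The square root is differentiable only where the radicand is positive. At `ε = 0` the radicand
  -- is `1 + c₀² > 0`, so the slice `ε = 0` lies in `U`.
  let U : Set (ℝ × ℝ × ℝ) := {z | 0 < P z.1 z.2.1 z.2.2}
  have hU : IsOpen U := isOpen_lt continuous_const hP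
  have hne : ∀ z ∈ U, √(P z.1 z.2.1 z.2.2) ≠ 0 := fun z hz => (Real.sqrt_pos.2 hz).ne'
  have h0U : ∀ s t, ((0 : ℝ), (s, t)) ∈ U := fun s t => by
    simp only [U, P, mem_ofPred_eq]
    nlinarith [sq_nonneg (c₀ s t)]
  rw [iteratedDeriv_two_integral_integral (U := U)
    (F' := fun ε s t => P' ε s t / (2 * √(P ε s t)) +
      (m₁ s t + 2 * ε * m₂ s t + 3 * ε ^ 2 * m₃ s t + 4 * ε ^ 3 * m₄ s t))
    (F'' := fun ε s t => P'' ε s t / (2 * √(P ε s t)) - P' ε s t ^ 2 / (4 * √(P ε s t) ^ 3) +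
      (2 * m₂ s t + 6 * ε * m₃ s t + 12 * ε ^ 2 * m₄ s t)) hU hab hcd]
  · congr 1; ext s; congr 1; ext t
    have hs : √(P 0 s t) = √(1 + c₀ s t ^ 2) := by simp [P]
    have hs0 : √(1 + c₀ s t ^ 2) ≠ 0 := hs ▸ hne _ (h0U s t)
    simp only [hs]
    simp only [P', P'']
    field_simp
    ring
  · have : Continuous fun z : ℝ × ℝ × ℝ => √(P z.1 z.2.1 z.2.2) +
        (m₀ z.2.1 z.2.2 + z.1 * m₁ z.2.1 z.2.2 + z.1 ^ 2 * m₂ z.2.1 z.2.2 +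
          z.1 ^ 3 * m₃ z.2.1 z.2.2 + z.1 ^ 4 * m₄ z.2.1 z.2.2) := by fun_prop
    exact this.continuousOn
  · refine ContinuousOn.add (hP'.continuousOn.div (by fun_prop) fun z hz => ?_) (by fun_prop)
    exact mul_ne_zero two_ne_zero (hne z hz)
  · refine ContinuousOn.add (ContinuousOn.sub
      (hP''.continuousOn.div (by fun_prop) fun z hz => ?_)
      ((hP'.pow 2).continuousOn.div (by fun_prop) fun z hz => ?_)) (by fun_prop)
    · exact mul_ne_zero two_ne_zero (hne z hz)
    · exact mul_ne_zero four_ne_zero (pow_ne_zero 3 (hne z hz))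
  · rintro ⟨ε, s, t⟩ hz
    have h0 := hasDerivAt_id' ε
    have := ((dP ε s t).sqrt (ne_of_gt hz)).add
      ((((h0.mul_const (m₁ s t)).const_add (m₀ s t)).add ((h0.pow 2).mul_const (m₂ s t))).add
        ((h0.pow 3).mul_const (m₃ s t)) |>.add ((h0.pow 4).mul_const (m₄ s t)))
    refine this.congr_deriv ?_
    simp
  · rintro ⟨ε, s, t⟩ hz
    have h0 := hasDerivAt_id' ε
    have hne' : √(P ε s t) ≠ 0 := hne _ hz
    have := ((dP' ε s t).div (((dP ε s t).sqrt (ne_of_gt hz)).const_mul 2)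
      (mul_ne_zero two_ne_zero hne')).add
      ((((h0.const_mul 2).mul_const (m₂ s t)).const_add (m₁ s t)).add
        (((h0.pow 2).const_mul 3).mul_const (m₃ s t)) |>.add
        (((h0.pow 3).const_mul 4).mul_const (m₄ s t)))
    refine this.congr_deriv ?_
    simp
    field_simp
    ring
  · exact fun p _ => h0U p.1 p.2

/-! ### Vectors in the rotating frame. -/

theorem hasDerivAt_vec3 {f g k : ℝ → ℝ} {f' g' k' r : ℝ} (hf : HasDerivAt f f' r)
    (hg : HasDerivAt g g' r) (hk : HasDerivAt k k' r) :
    HasDerivAt (fun u => ![f u, g u, k u]) ![f', g', k'] r := by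
  rw [hasDerivAt_pi]
  intro i
  fin_cases i <;> simpa

/-- The vector whose horizontal part is `(p, q)`, rotated by the angle `-θ`, and whose height is
`z`. -/
def rotVec (θ p q z : ℝ) : Fin 3 → ℝ :=
  ![p * Real.cos θ + q * Real.sin θ, -p * Real.sin θ + q * Real.cos θ, z]

/-- Rotations preserve dot and cross products, so the angle `ω t` drops out of all scalar densities
below. -/
theorem rotVec_dot (θ p q z p' q' z' : ℝ) :
    rotVec θ p q z ⬝ᵥ rotVec θ p' q' z' = p * p' + q * q' + z * z' := by
  simp only [rotVec, Matrix.vec3_dotProduct, Matrix.cons_val]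
  linear_combination (p * p' + q * q') * Real.sin_sq_add_cos_sq θ

theorem rotVec_cross (θ p q z p' q' z' : ℝ) :
    rotVec θ p q z ⨯₃ rotVec θ p' q' z' =
      rotVec θ (q * z' - z * q') (z * p' - p * z') (p * q' - q * p') := by
  rw [cross_apply]
  simp only [rotVec, Matrix.cons_val]
  congr 1
  · ring
  congr 1
  · ring
  congr 1
  linear_combination (p * q' - q * p') * Real.sin_sq_add_cos_sq θ

theorem smul_rotVec (r θ p q z : ℝ) : r • rotVec θ p q z = rotVec θ (r * p) (r * q) (r * z) := by
  ext i
  fin_cases i <;> simp [rotVec] <;> ring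

theorem axisDistSq_rotVec (θ p q z : ℝ) : axisDistSq (rotVec θ p q z) = p ^ 2 + q ^ 2 := by
  simp only [axisDistSq, rotVec, Matrix.cons_val]
  linear_combination (p ^ 2 + q ^ 2) * Real.sin_sq_add_cos_sq θ

theorem fieldW₀_rotVec (θ p q z : ℝ) :
    fieldW₀ (rotVec θ p q z) = rotVec θ (p / 2) (q / 2) 0 := by
  ext i
  fin_cases i <;> simp [fieldW₀, rotVec] <;> ring

theorem fieldW_rotVec (θ p q z : ℝ) :
    fieldW (rotVec θ p q z) = rotVec θ ((p ^ 2 + q ^ 2) / 4 * p) ((p ^ 2 + q ^ 2) / 4 * q) 0 := by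
  unfold fieldW
  rw [axisDistSq_rotVec]
  ext i
  fin_cases i <;> simp [rotVec] <;> ring

theorem hasDerivAt_rotVec {ω p' q' z' r : ℝ} {p q z : ℝ → ℝ} (hp : HasDerivAt p p' r)
    (hq : HasDerivAt q q' r) (hz : HasDerivAt z z' r) :
    HasDerivAt (fun t => rotVec (ω * t) (p t) (q t) (z t))
      (rotVec (ω * r) (p' + ω * q r) (q' - ω * p r) z') r := by
  have hθ := (hasDerivAt_id' r).const_mul ω
  refine (hasDerivAt_vec3 ((hp.mul hθ.cos).add (hq.mul hθ.sin))
    ((hp.neg.mul hθ.sin).add (hq.mul hθ.cos)) hz).congr_deriv ?_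
  ext i
  fin_cases i <;> simp [rotVec] <;> ring

theorem hasDerivAt_rotVec_const {θ p' q' z' r : ℝ} {p q z : ℝ → ℝ} (hp : HasDerivAt p p' r)
    (hq : HasDerivAt q q' r) (hz : HasDerivAt z z' r) :
    HasDerivAt (fun s => rotVec θ (p s) (q s) (z s)) (rotVec θ p' q' z') r :=
  hasDerivAt_vec3 ((hp.mul_const _).add (hq.mul_const _))
    ((hp.neg.mul_const _).add (hq.mul_const _)) hz

/-! ### Area density and energy of twisted surfaces. -/

/-- The surface whose horizontal slices are the curves `s ↦ (p s t, q s t)`, rotated with angular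
speed `-ω`. -/
def twisted (ω : ℝ) (p q : ℝ → ℝ → ℝ) (s t : ℝ) : Fin 3 → ℝ :=
  rotVec (ω * t) (p s t) (q s t) t

theorem helicoidal_eq_twisted (ω : ℝ) (x y : ℝ → ℝ) :
    helicoidal ω x y = twisted ω (fun s _ => x s) (fun s _ => y s) := rfl

section Twisted

variable {ω s t ps qs pt qt : ℝ} {p q : ℝ → ℝ → ℝ}

theorem dS_twisted (hps : HasDerivAt (fun u => p u t) ps s)
    (hqs : HasDerivAt (fun u => q u t) qs s) :
    dS (twisted ω p q) s t = rotVec (ω * t) ps qs 0 :=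
  (hasDerivAt_rotVec_const hps hqs (hasDerivAt_const s t)).deriv

theorem dT_twisted (hpt : HasDerivAt (fun u => p s u) pt t)
    (hqt : HasDerivAt (fun u => q s u) qt t) :
    dT (twisted ω p q) s t = rotVec (ω * t) (pt + ω * q s t) (qt - ω * p s t) 1 :=
  (hasDerivAt_rotVec hpt hqt (hasDerivAt_id' t)).deriv

theorem cross_twisted (hps : HasDerivAt (fun u => p u t) ps s)
    (hqs : HasDerivAt (fun u => q u t) qs s) (hpt : HasDerivAt (fun u => p s u) pt t)
    (hqt : HasDerivAt (fun u => q s u) qt t) :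
    dS (twisted ω p q) s t ⨯₃ dT (twisted ω p q) s t =
      rotVec (ω * t) qs (-ps) (ps * (qt - ω * p s t) - qs * (pt + ω * q s t)) := by
  rw [dS_twisted hps hqs, dT_twisted hpt hqt, rotVec_cross]
  congr 1 <;> ring

theorem areaDensity_twisted (hps : HasDerivAt (fun u => p u t) ps s)
    (hqs : HasDerivAt (fun u => q u t) qs s) (hpt : HasDerivAt (fun u => p s u) pt t)
    (hqt : HasDerivAt (fun u => q s u) qt t) :
    areaDensity (twisted ω p q) s t =
      √(ps ^ 2 + qs ^ 2 + (ps * (qt - ω * p s t) - qs * (pt + ω * q s t)) ^ 2) := by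
  rw [areaDensity, cross_twisted hps hqs hpt hqt, rotVec_dot]
  congr 1
  ring

end Twisted

/-- The flux density needs no immersion hypothesis: where the area density vanishes, so does the
cross product, and both sides are `0`. Hence the energy formula holds for every `ε`. -/
theorem dotProduct_unitNormal_mul_areaDensity (X : ℝ → ℝ → Fin 3 → ℝ) (s t : ℝ) (v : Fin 3 → ℝ) :
    v ⬝ᵥ unitNormal X s t * areaDensity X s t = v ⬝ᵥ (dS X s t ⨯₃ dT X s t) := by
  rw [unitNormal, dotProduct_smul, smul_eq_mul]
  by_cases h : areaDensity X s t = 0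
  · have h0 : (dS X s t ⨯₃ dT X s t) = 0 := by
      have hnn : 0 ≤ (dS X s t ⨯₃ dT X s t) ⬝ᵥ (dS X s t ⨯₃ dT X s t) :=
        Finset.sum_nonneg fun i _ => mul_self_nonneg _
      exact dotProduct_self_eq_zero.1 ((Real.sqrt_eq_zero hnn).1 h)
    simp [h, h0]
  · field_simp

theorem continuous_uncurry_intervalIntegral {G : ℝ → ℝ → ℝ} (hG : Continuous G.uncurry)
    (c d : ℝ) : Continuous fun s => ∫ t in c..d, G s t :=
  intervalIntegral.continuous_parametric_intervalIntegral_of_continuous' hG c d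

theorem intervalIntegral_integral_add {F G : ℝ → ℝ → ℝ} (hF : Continuous F.uncurry)
    (hG : Continuous G.uncurry) (a b c d : ℝ) :
    ∫ s in a..b, ∫ t in c..d, (F s t + G s t) =
      (∫ s in a..b, ∫ t in c..d, F s t) + ∫ s in a..b, ∫ t in c..d, G s t := by
  rw [← intervalIntegral.integral_add
    ((continuous_uncurry_intervalIntegral hF c d).intervalIntegrable _ _)
    ((continuous_uncurry_intervalIntegral hG c d).intervalIntegrable _ _)]
  congr 1; ext s
  exact intervalIntegral.integral_add
    ((hF.comp (Continuous.prodMk_right s)).intervalIntegrable _ _)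
    ((hG.comp (Continuous.prodMk_right s)).intervalIntegrable _ _)

/-- The energy of a twisted surface as the integral of a Lagrangian. -/
theorem energy_twisted {a Λ₀ ℓ h ω : ℝ} {p q ps qs pt qt : ℝ → ℝ → ℝ}
    (hps : ∀ s t, HasDerivAt (fun u => p u t) (ps s t) s)
    (hqs : ∀ s t, HasDerivAt (fun u => q u t) (qs s t) s)
    (hpt : ∀ s t, HasDerivAt (fun u => p s u) (pt s t) t)
    (hqt : ∀ s t, HasDerivAt (fun u => q s u) (qt s t) t)
    (cp : Continuous p.uncurry) (cq : Continuous q.uncurry) (cps : Continuous ps.uncurry)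
    (cqs : Continuous qs.uncurry) (cpt : Continuous pt.uncurry) (cqt : Continuous qt.uncurry) :
    energy a Λ₀ ℓ h (twisted ω p q) = ∫ s in (0 : ℝ)..ℓ, ∫ t in (-(h / 2))..(h / 2),
      (√(ps s t ^ 2 + qs s t ^ 2 +
          (ps s t * (qt s t - ω * p s t) - qs s t * (pt s t + ω * q s t)) ^ 2) +
        (Λ₀ / 2 - a / 8 * (p s t ^ 2 + q s t ^ 2)) * (p s t * qs s t - q s t * ps s t)) := by
  unfold Function.uncurry at *
  simp only [energy, surfaceArea, volume, inertia, surfaceIntegral,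
    dotProduct_unitNormal_mul_areaDensity, one_mul]
  have hA : ∀ s t, areaDensity (twisted ω p q) s t = √(ps s t ^ 2 + qs s t ^ 2 +
      (ps s t * (qt s t - ω * p s t) - qs s t * (pt s t + ω * q s t)) ^ 2) := fun s t =>
    areaDensity_twisted (hps s t) (hqs s t) (hpt s t) (hqt s t)
  have hI : ∀ s t, fieldW (twisted ω p q s t) ⬝ᵥ
      (dS (twisted ω p q) s t ⨯₃ dT (twisted ω p q) s t) =
      (p s t ^ 2 + q s t ^ 2) / 4 * (p s t * qs s t - q s t * ps s t) := fun s t => by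
    rw [cross_twisted (hps s t) (hqs s t) (hpt s t) (hqt s t), twisted, fieldW_rotVec, rotVec_dot]
    ring
  have hV : ∀ s t, fieldW₀ (twisted ω p q s t) ⬝ᵥ
      (dS (twisted ω p q) s t ⨯₃ dT (twisted ω p q) s t) =
      1 / 2 * (p s t * qs s t - q s t * ps s t) := fun s t => by
    rw [cross_twisted (hps s t) (hqs s t) (hpt s t) (hqt s t), twisted, fieldW₀_rotVec, rotVec_dot]
    ring
  simp only [hA, hI, hV]
  rw [sub_eq_add_neg, ← neg_mul]
  simp only [← intervalIntegral.integral_const_mul]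
  rw [← intervalIntegral_integral_add, ← intervalIntegral_integral_add]
  · congr 1; ext s; congr 1; ext t; ring
  all_goals unfold Function.uncurry; fun_prop

/-! ### The profile curve in its moving frame. -/

/-- The signed curvature of the plane curve `(x, y)` in a unit speed parametrization. -/
def signedCurvature (x y : ℝ → ℝ) (s : ℝ) : ℝ :=
  deriv x s * deriv (deriv y) s - deriv y s * deriv (deriv x) s

/-- The support function `x y' - y x'`. -/
def support (x y : ℝ → ℝ) (s : ℝ) : ℝ := x s * deriv y s - y s * deriv x s

/-- The area density `√(1 + ω² ξ₁²)` of the helicoidal surface. -/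
def helicoidalDensity (ω : ℝ) (x y : ℝ → ℝ) (s : ℝ) : ℝ := √(1 + ω ^ 2 * xi₁ x y s ^ 2)

/-- The derivative of `helicoidalDensity`. -/
def helicoidalDensityDeriv (ω : ℝ) (x y : ℝ → ℝ) (s : ℝ) : ℝ :=
  ω ^ 2 * xi₁ x y s * (1 - signedCurvature x y s * support x y s) / helicoidalDensity ω x y s

theorem helicoidalDensity_pos (ω : ℝ) (x y : ℝ → ℝ) (s : ℝ) : 0 < helicoidalDensity ω x y s :=
  Real.sqrt_pos.2 (by positivity)

theorem helicoidalDensity_sq (ω : ℝ) (x y : ℝ → ℝ) (s : ℝ) :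
    helicoidalDensity ω x y s ^ 2 = 1 + ω ^ 2 * xi₁ x y s ^ 2 :=
  Real.sq_sqrt (by positivity)

namespace IsClosedCurve

variable {x y : ℝ → ℝ} {ℓ : ℝ} (hα : IsClosedCurve x y ℓ)
include hα

theorem contDiff_deriv_x : ContDiff ℝ (⊤ : ℕ∞) (deriv x) :=
  (contDiff_infty_iff_deriv.1 hα.smooth_x).2

theorem contDiff_deriv_y : ContDiff ℝ (⊤ : ℕ∞) (deriv y) :=
  (contDiff_infty_iff_deriv.1 hα.smooth_y).2

theorem contDiff_deriv_deriv_x : ContDiff ℝ (⊤ : ℕ∞) (deriv (deriv x)) :=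
  (contDiff_infty_iff_deriv.1 hα.contDiff_deriv_x).2

theorem contDiff_deriv_deriv_y : ContDiff ℝ (⊤ : ℕ∞) (deriv (deriv y)) :=
  (contDiff_infty_iff_deriv.1 hα.contDiff_deriv_y).2

theorem hasDerivAt_x (s : ℝ) : HasDerivAt x (deriv x s) s :=
  (hα.smooth_x.differentiable (by simp) s).hasDerivAt

theorem hasDerivAt_y (s : ℝ) : HasDerivAt y (deriv y s) s :=
  (hα.smooth_y.differentiable (by simp) s).hasDerivAt

theorem orthogonal (s : ℝ) :
    deriv x s * deriv (deriv x) s + deriv y s * deriv (deriv y) s = 0 := by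
  have h1 := ((hα.contDiff_deriv_x.differentiable (by simp) s).hasDerivAt.pow 2).add
    ((hα.contDiff_deriv_y.differentiable (by simp) s).hasDerivAt.pow 2)
  have h2 : (deriv x ^ 2 + deriv y ^ 2) = fun _ => (1 : ℝ) := by
    ext u
    simpa using hα.arc_length u
  rw [h2] at h1
  have := h1.unique (hasDerivAt_const s 1)
  simp at this
  linarith

/-- Frenet equation: at unit speed the acceleration has no tangential part, so it is the curvature
times the normal. -/
theorem hasDerivAt_deriv_x (s : ℝ) :
    HasDerivAt (deriv x) (-(signedCurvature x y s * deriv y s)) s := by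
  refine (hα.contDiff_deriv_x.differentiable (by simp) s).hasDerivAt.congr_deriv ?_
  unfold signedCurvature
  linear_combination -deriv (deriv x) s * hα.arc_length s + deriv x s * hα.orthogonal s

theorem hasDerivAt_deriv_y (s : ℝ) :
    HasDerivAt (deriv y) (signedCurvature x y s * deriv x s) s := by
  refine (hα.contDiff_deriv_y.differentiable (by simp) s).hasDerivAt.congr_deriv ?_
  unfold signedCurvature
  linear_combination -deriv (deriv y) s * hα.arc_length s + deriv y s * hα.orthogonal s

/-- With `hasDerivAt_support` this closes the system `ξ' = 1 - κη`, `η' = κξ` for the position in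
the moving frame; later computations only need `ξ`, `η`, `κ`. -/
theorem hasDerivAt_xi₁ (s : ℝ) :
    HasDerivAt (xi₁ x y) (1 - signedCurvature x y s * support x y s) s := by
  refine (((hα.hasDerivAt_x s).mul (hα.hasDerivAt_deriv_x s)).add
    ((hα.hasDerivAt_y s).mul (hα.hasDerivAt_deriv_y s))).congr_deriv ?_
  unfold support
  linear_combination hα.arc_length s

theorem hasDerivAt_support (s : ℝ) :
    HasDerivAt (support x y) (signedCurvature x y s * xi₁ x y s) s := by
  refine (((hα.hasDerivAt_x s).mul (hα.hasDerivAt_deriv_y s)).sub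
    ((hα.hasDerivAt_y s).mul (hα.hasDerivAt_deriv_x s))).congr_deriv ?_
  unfold xi₁
  ring

theorem hasDerivAt_helicoidalDensity (ω s : ℝ) :
    HasDerivAt (helicoidalDensity ω x y) (helicoidalDensityDeriv ω x y s) s := by
  refine ((((hα.hasDerivAt_xi₁ s).pow 2).const_mul (ω ^ 2)).const_add 1 |>.sqrt
    (ne_of_gt (by simp only [Pi.pow_apply]; positivity))).congr_deriv ?_
  simp only [helicoidalDensityDeriv, helicoidalDensity, Pi.pow_apply]
  field_simp
  simp
  ring

theorem contDiff_helicoidalDensity (ω : ℝ) :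
    ContDiff ℝ (⊤ : ℕ∞) (helicoidalDensity ω x y) := by
  have hx := hα.smooth_x
  have hy := hα.smooth_y
  have hx' := hα.contDiff_deriv_x
  have hy' := hα.contDiff_deriv_y
  refine ContDiff.sqrt ?_ fun s => by positivity
  unfold xi₁
  fun_prop

theorem continuous_signedCurvature : Continuous (signedCurvature x y) := by
  have hx' := hα.contDiff_deriv_x.continuous
  have hy' := hα.contDiff_deriv_y.continuous
  have hx'' := hα.contDiff_deriv_deriv_x.continuous
  have hy'' := hα.contDiff_deriv_deriv_y.continuous
  unfold signedCurvature
  fun_prop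

theorem continuous_xi₁ : Continuous (xi₁ x y) :=
  continuous_iff_continuousAt.2 fun s => (hα.hasDerivAt_xi₁ s).continuousAt

theorem continuous_support : Continuous (support x y) :=
  continuous_iff_continuousAt.2 fun s => (hα.hasDerivAt_support s).continuousAt

theorem continuous_helicoidalDensityDeriv (ω : ℝ) :
    Continuous (helicoidalDensityDeriv ω x y) := by
  have h1 := hα.continuous_signedCurvature
  have h2 := hα.continuous_support
  have h3 := hα.continuous_xi₁
  have h4 := (hα.contDiff_helicoidalDensity ω).continuous
  unfold helicoidalDensityDeriv
  exact Continuous.div (by fun_prop) h4 fun s => (helicoidalDensity_pos ω x y s).ne'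

theorem deriv_x_periodic (s : ℝ) : deriv x (s + ℓ) = deriv x s := by
  rw [← deriv_comp_add_const]
  simp only [hα.periodic_x]

theorem deriv_y_periodic (s : ℝ) : deriv y (s + ℓ) = deriv y s := by
  rw [← deriv_comp_add_const]
  simp only [hα.periodic_y]

theorem xi₁_periodic (s : ℝ) : xi₁ x y (s + ℓ) = xi₁ x y s := by
  simp only [xi₁, hα.periodic_x, hα.periodic_y, hα.deriv_x_periodic, hα.deriv_y_periodic]

theorem support_periodic (s : ℝ) : support x y (s + ℓ) = support x y s := by
  simp only [support, hα.periodic_x, hα.periodic_y, hα.deriv_x_periodic, hα.deriv_y_periodic]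

theorem helicoidalDensity_periodic (ω s : ℝ) :
    helicoidalDensity ω x y (s + ℓ) = helicoidalDensity ω x y s := by
  simp only [helicoidalDensity, hα.xi₁_periodic]

theorem xi₁_sq_add_support_sq (s : ℝ) :
    xi₁ x y s ^ 2 + support x y s ^ 2 = x s ^ 2 + y s ^ 2 := by
  unfold xi₁ support
  linear_combination (x s ^ 2 + y s ^ 2) * hα.arc_length s

/-! ### Normal, area density and mean curvature of the helicoidal surface. -/

theorem cross_helicoidal (ω s t : ℝ) :
    dS (helicoidal ω x y) s t ⨯₃ dT (helicoidal ω x y) s t =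
      rotVec (ω * t) (deriv y s) (-deriv x s) (-(ω * xi₁ x y s)) := by
  rw [helicoidal_eq_twisted, cross_twisted (hα.hasDerivAt_x s) (hα.hasDerivAt_y s)
    (hasDerivAt_const t _) (hasDerivAt_const t _), xi₁]
  congr 1
  ring

theorem areaDensity_helicoidal (ω s t : ℝ) :
    areaDensity (helicoidal ω x y) s t = helicoidalDensity ω x y s := by
  rw [areaDensity, hα.cross_helicoidal, rotVec_dot, helicoidalDensity]
  congr 1
  linear_combination hα.arc_length s

/-- The mean curvature of the helicoidal surface, up to the factor `2 (1 + ω² ξ₁²)^(3/2)`. -/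
theorem two_mul_meanCurvature_helicoidal (ω s t : ℝ) :
    2 * meanCurvature (helicoidal ω x y) s t * helicoidalDensity ω x y s ^ 3 =
      -signedCurvature x y s * (1 + ω ^ 2 * (xi₁ x y s ^ 2 + support x y s ^ 2)) +
        ω ^ 2 * support x y s := by
  have hS : dS (helicoidal ω x y) = fun s t => rotVec (ω * t) (deriv x s) (deriv y s) 0 := by
    ext1 s; ext1 t
    exact dS_twisted (p := fun s _ => x s) (q := fun s _ => y s)
      (hα.hasDerivAt_x s) (hα.hasDerivAt_y s)
  have hT : dT (helicoidal ω x y) = fun s t => rotVec (ω * t) (ω * y s) (-ω * x s) 1 := by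
    ext1 s; ext1 t
    rw [helicoidal_eq_twisted, dT_twisted (hasDerivAt_const t _) (hasDerivAt_const t _)]
    congr 1 <;> ring
  have hSS : dS (dS (helicoidal ω x y)) s t = rotVec (ω * t)
      (-(signedCurvature x y s * deriv y s)) (signedCurvature x y s * deriv x s) 0 := by
    rw [hS]
    exact (hasDerivAt_rotVec_const (hα.hasDerivAt_deriv_x s) (hα.hasDerivAt_deriv_y s)
      (hasDerivAt_const s _)).deriv
  have hST : dS (dT (helicoidal ω x y)) s t =
      rotVec (ω * t) (ω * deriv y s) (-ω * deriv x s) 0 := by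
    rw [hT]
    exact (hasDerivAt_rotVec_const ((hα.hasDerivAt_y s).const_mul ω)
      ((hα.hasDerivAt_x s).const_mul (-ω)) (hasDerivAt_const s _)).deriv
  have hTT : dT (dT (helicoidal ω x y)) s t =
      rotVec (ω * t) (-ω ^ 2 * x s) (-ω ^ 2 * y s) 0 := by
    rw [hT]
    refine (hasDerivAt_rotVec (hasDerivAt_const t _) (hasDerivAt_const t _)
      (hasDerivAt_const t _)).deriv.trans ?_
    congr 1 <;> ring
  have hW := (helicoidalDensity_pos ω x y s).ne'
  have harc := hα.arc_length s
  -- This is `E G - F²`, in the unsimplified form produced by `rotVec_dot`.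
  have hEG : (deriv x s * deriv x s + deriv y s * deriv y s + 0 * 0) *
      (ω * y s * (ω * y s) + -ω * x s * (-ω * x s) + 1 * 1) -
      (deriv x s * (ω * y s) + deriv y s * (-ω * x s) + 0 * 1) ^ 2 =
      helicoidalDensity ω x y s ^ 2 := by
    rw [helicoidalDensity_sq, xi₁]
    linear_combination harc
  simp only [meanCurvature, hSS, hST, hTT, unitNormal, hα.areaDensity_helicoidal,
    hα.cross_helicoidal, smul_rotVec]
  simp only [hS, hT, rotVec_dot, hEG]
  field_simp
  unfold xi₁ support
  generalize signedCurvature x y s = κ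
  linear_combination (-κ + ω ^ 2 * (x s * deriv y s - y s * deriv x s)) * harc

end IsClosedCurve

/-! ### The test variation and its second variation. -/

theorem integral_trigonometric_form {h k : ℝ} (hk : k ≠ 0) (hkh : k * (h / 2) = Real.pi)
    (A B C : ℝ) :
    ∫ t in (-(h / 2))..(h / 2), (A * Real.cos (k * t) ^ 2 +
      B * (Real.sin (k * t) * Real.cos (k * t)) + C * Real.sin (k * t) ^ 2) =
      h / 2 * (A + C) := by
  -- An explicit primitive. As `k t` runs over `[-π, π]`, its trigonometric terms vanish at both
  -- ends.
  have hd : ∀ t : ℝ, HasDerivAt (fun t => (A + C) / 2 * t +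
      (A - C) / (2 * k) * (Real.sin (k * t) * Real.cos (k * t)) +
      B / (2 * k) * Real.sin (k * t) ^ 2)
      (A * Real.cos (k * t) ^ 2 + B * (Real.sin (k * t) * Real.cos (k * t)) +
        C * Real.sin (k * t) ^ 2) t := by
    intro t
    have h0 := (hasDerivAt_id' t).const_mul k
    refine ((((hasDerivAt_id' t).const_mul ((A + C) / 2)).add
      ((h0.sin.mul h0.cos).const_mul ((A - C) / (2 * k)))).add
      ((h0.sin.pow 2).const_mul (B / (2 * k)))).congr_deriv ?_
    simp
    field_simp
    linear_combination (-(A + C)) * Real.sin_sq_add_cos_sq (k * t)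
  rw [intervalIntegral.integral_eq_sub_of_hasDerivAt (fun t _ => hd t)
    (Continuous.intervalIntegrable (by fun_prop) _ _)]
  simp only [mul_neg, hkh, Real.sin_neg, Real.sin_pi]
  ring

/-- The `s`-dependent coefficient of the energy of a variation, before integration by parts. -/
def variationCoeff (a Λ₀ ω : ℝ) (x y : ℝ → ℝ) (s : ℝ) : ℝ :=
  let κ := signedCurvature x y s
  let ξ := xi₁ x y s
  let η := support x y s
  let W := helicoidalDensity ω x y s
  let W' := helicoidalDensityDeriv ω x y s
  ((κ * W) ^ 2 + W' ^ 2 + (ω * ξ * κ * W + ω * η * W') ^ 2 + 2 * ω ^ 2 * ξ * W * W') / W -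
    (κ * W + ω * ξ * (ω * ξ * κ * W + ω * η * W')) ^ 2 / W ^ 3 +
    2 * ((Λ₀ / 2 - a / 8 * (ξ ^ 2 + η ^ 2)) * κ * W ^ 2 -
      a / 4 * W * η * (W * κ * η - W' * ξ + W) - a / 8 * W ^ 2 * η)

/-- The horizontal variation of a helicoidal surface with normal component `ε sin (k t)`. -/
def sineVariation (k ω : ℝ) (x y : ℝ → ℝ) (ε : ℝ) : ℝ → ℝ → Fin 3 → ℝ :=
  twisted ω
    (fun s t => x s + ε * (helicoidalDensity ω x y s * Real.sin (k * t) * deriv y s))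
    (fun s t => y s - ε * (helicoidalDensity ω x y s * Real.sin (k * t) * deriv x s))

namespace IsClosedCurve

variable {x y : ℝ → ℝ} {ℓ : ℝ} (hα : IsClosedCurve x y ℓ)
include hα

theorem isVariation_sineVariation {h k : ℝ} (hkh : k * (h / 2) = Real.pi) (ω : ℝ) :
    IsVariation ℓ h (helicoidal ω x y) (sineVariation k ω x y) where
  smooth := by
    have hx := hα.smooth_x
    have hy := hα.smooth_y
    have hx' := hα.contDiff_deriv_x
    have hy' := hα.contDiff_deriv_y
    have hW := hα.contDiff_helicoidalDensity ω
    rw [contDiff_pi]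
    intro i
    fin_cases i <;> simp [sineVariation, twisted, rotVec] <;> fun_prop
  periodic ε s t := by
    simp only [sineVariation, twisted, hα.periodic_x, hα.periodic_y, hα.deriv_x_periodic,
      hα.deriv_y_periodic, hα.helicoidalDensity_periodic]
  start s t _ := by simp [sineVariation, helicoidal_eq_twisted, twisted]
  fixed_bot ε s := by
    simp [sineVariation, helicoidal_eq_twisted, twisted, hkh]
  fixed_top ε s := by
    simp [sineVariation, helicoidal_eq_twisted, twisted, hkh]

theorem normalComponent_sineVariation (k ω s t : ℝ) :
    normalComponent (helicoidal ω x y) (sineVariation k ω x y) s t = Real.sin (k * t) := by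
  have hd : HasDerivAt (fun ε => sineVariation k ω x y ε s t)
      (rotVec (ω * t) (helicoidalDensity ω x y s * Real.sin (k * t) * deriv y s)
        (-(helicoidalDensity ω x y s * Real.sin (k * t) * deriv x s)) 0) 0 := by
    have h0 := hasDerivAt_id' (0 : ℝ)
    refine (hasDerivAt_rotVec_const ((h0.mul_const _).const_add _)
      ((h0.mul_const _).const_sub _) (hasDerivAt_const 0 t)).congr_deriv ?_
    simp
  have hW := (helicoidalDensity_pos ω x y s).ne'
  rw [normalComponent, hd.deriv, unitNormal, hα.areaDensity_helicoidal, hα.cross_helicoidal,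
    smul_rotVec, rotVec_dot]
  field_simp
  linear_combination helicoidalDensity ω x y s * Real.sin (k * t) * hα.arc_length s

/-- The second variation of the energy along `sineVariation`. -/
theorem iteratedDeriv_energy_sineVariation {h k : ℝ} (hh : 0 < h) (hk : k ≠ 0)
    (hkh : k * (h / 2) = Real.pi) (a Λ₀ ω : ℝ) :
    iteratedDeriv 2 (fun ε => energy a Λ₀ ℓ h (sineVariation k ω x y ε)) 0 =
      ∫ s in (0 : ℝ)..ℓ,
        h / 2 * (k ^ 2 * (1 / helicoidalDensity ω x y s) + variationCoeff a Λ₀ ω x y s) := by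
  have cx := hα.smooth_x.continuous
  have cy := hα.smooth_y.continuous
  have cx' := hα.contDiff_deriv_x.continuous
  have cy' := hα.contDiff_deriv_y.continuous
  have cκ := hα.continuous_signedCurvature
  have cξ := hα.continuous_xi₁
  have cη := hα.continuous_support
  have cW := (hα.contDiff_helicoidalDensity ω).continuous
  have cW' := hα.continuous_helicoidalDensityDeriv ω
  set κ := signedCurvature x y with hκ
  set ξ := xi₁ x y with hξ
  set η := support x y with hη
  set W := helicoidalDensity ω x y with hW
  set W' := helicoidalDensityDeriv ω x y with hW'
  have hWne : ∀ s, W s ≠ 0 := fun s => (helicoidalDensity_pos ω x y s).ne'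
  have hg : ∀ t, HasDerivAt (fun t => Real.sin (k * t)) (k * Real.cos (k * t)) t := fun t => by
    simpa [mul_comm] using ((hasDerivAt_id' t).const_mul k).sin
  have hps : ∀ ε s t, HasDerivAt (fun u => x u + ε * (W u * Real.sin (k * t) * deriv y u))
      ((1 + ε * (W s * Real.sin (k * t) * κ s)) * deriv x s +
        ε * (W' s * Real.sin (k * t)) * deriv y s) s := fun ε s t => by
    refine ((hα.hasDerivAt_x s).add (((((hα.hasDerivAt_helicoidalDensity ω s).mul_const
      (Real.sin (k * t))).mul (hα.hasDerivAt_deriv_y s))).const_mul ε)).congr_deriv ?_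
    ring
  have hqs : ∀ ε s t, HasDerivAt (fun u => y u - ε * (W u * Real.sin (k * t) * deriv x u))
      ((1 + ε * (W s * Real.sin (k * t) * κ s)) * deriv y s -
        ε * (W' s * Real.sin (k * t)) * deriv x s) s := fun ε s t => by
    refine ((hα.hasDerivAt_y s).sub (((((hα.hasDerivAt_helicoidalDensity ω s).mul_const
      (Real.sin (k * t))).mul (hα.hasDerivAt_deriv_x s))).const_mul ε)).congr_deriv ?_
    ring
  have hpt : ∀ ε s t, HasDerivAt (fun u => x s + ε * (W s * Real.sin (k * u) * deriv y s))
      (ε * (W s * (k * Real.cos (k * t)) * deriv y s)) t := fun ε s t =>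
    ((((hg t).const_mul (W s)).mul_const (deriv y s)).const_mul ε).const_add _
  have hqt : ∀ ε s t, HasDerivAt (fun u => y s - ε * (W s * Real.sin (k * u) * deriv x s))
      (-(ε * (W s * (k * Real.cos (k * t)) * deriv x s))) t := fun ε s t =>
    ((((hg t).const_mul (W s)).mul_const (deriv x s)).const_mul ε).const_sub _
  -- Here `u` is the horizontal displacement and `us`, `ut` are its partial derivatives. The `cᵢ`
  -- are the coefficients in `ε` of minus the vertical component of `X_s × X_t`, the `mᵢ` those of
  -- the inertia and volume density, and `r₁` is the linear coefficient of `p q_s - q p_s`.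
  let u : ℝ → ℝ → ℝ := fun s t => W s * Real.sin (k * t)
  let us : ℝ → ℝ → ℝ := fun s t => W' s * Real.sin (k * t)
  let ut : ℝ → ℝ → ℝ := fun s t => W s * (k * Real.cos (k * t))
  let L : ℝ → ℝ := fun s => Λ₀ / 2 - a / 8 * (ξ s ^ 2 + η s ^ 2)
  let r₁ : ℝ → ℝ → ℝ := fun s t => u s t * κ s * η s - us s t * ξ s + u s t
  let f : ℝ → ℝ → ℝ := fun s t => u s t * κ s
  let c₀ : ℝ → ℝ → ℝ := fun s _ => ω * ξ s
  let c₁ : ℝ → ℝ → ℝ := fun s t => ω * ξ s * κ s * u s t + ω * η s * us s t + ut s t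
  let c₂ : ℝ → ℝ → ℝ := fun s t => κ s * u s t * ut s t + ω * u s t * us s t
  let m₀ : ℝ → ℝ → ℝ := fun s _ => L s * η s
  let m₁ : ℝ → ℝ → ℝ := fun s t => L s * r₁ s t - a / 4 * u s t * η s ^ 2
  let m₂ : ℝ → ℝ → ℝ := fun s t => L s * κ s * u s t ^ 2 - a / 4 * u s t * η s * r₁ s t -
    a / 8 * u s t ^ 2 * η s
  let m₃ : ℝ → ℝ → ℝ := fun s t => -(a / 4 * u s t ^ 3 * η s * κ s) - a / 8 * u s t ^ 2 * r₁ s t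
  let m₄ : ℝ → ℝ → ℝ := fun s t => -(a / 8 * u s t ^ 4 * κ s)
  have henergy : (fun ε => energy a Λ₀ ℓ h (sineVariation k ω x y ε)) = fun ε =>
      ∫ s in (0 : ℝ)..ℓ, ∫ t in (-(h / 2))..(h / 2),
      (√((1 + ε * f s t) ^ 2 + (ε * us s t) ^ 2 + (c₀ s t + ε * c₁ s t + ε ^ 2 * c₂ s t) ^ 2) +
        (m₀ s t + ε * m₁ s t + ε ^ 2 * m₂ s t + ε ^ 3 * m₃ s t + ε ^ 4 * m₄ s t)) := by
    ext ε
    rw [sineVariation, energy_twisted (hps ε) (hqs ε) (hpt ε) (hqt ε)]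
    · congr 1; ext s; congr 1; ext t
      have harc := hα.arc_length s
      have hRR : (x s + ε * (W s * Real.sin (k * t) * deriv y s)) ^ 2 +
          (y s - ε * (W s * Real.sin (k * t) * deriv x s)) ^ 2 =
          ξ s ^ 2 + η s ^ 2 + 2 * ε * u s t * η s + ε ^ 2 * u s t ^ 2 := by
        rw [hα.xi₁_sq_add_support_sq]
        simp only [u, hη, support]
        linear_combination (ε * W s * Real.sin (k * t)) ^ 2 * harc
      have hdet : (x s + ε * (W s * Real.sin (k * t) * deriv y s)) *
            ((1 + ε * (W s * Real.sin (k * t) * κ s)) * deriv y s -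
              ε * (W' s * Real.sin (k * t)) * deriv x s) -
          (y s - ε * (W s * Real.sin (k * t) * deriv x s)) *
            ((1 + ε * (W s * Real.sin (k * t) * κ s)) * deriv x s +
              ε * (W' s * Real.sin (k * t)) * deriv y s) =
          η s + ε * r₁ s t + ε ^ 2 * (κ s * u s t ^ 2) := by
        simp only [r₁, us, u, hη, support, hξ, xi₁]
        linear_combination (ε * W s * Real.sin (k * t) *
          (1 + ε * (W s * Real.sin (k * t) * κ s))) * harc
      rw [hRR, hdet]
      congr 1
      · congr 1
        have h1 : ((1 + ε * (W s * Real.sin (k * t) * κ s)) * deriv x s +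
              ε * (W' s * Real.sin (k * t)) * deriv y s) ^ 2 +
            ((1 + ε * (W s * Real.sin (k * t) * κ s)) * deriv y s -
              ε * (W' s * Real.sin (k * t)) * deriv x s) ^ 2 =
            (1 + ε * f s t) ^ 2 + (ε * us s t) ^ 2 := by
          simp only [f, us, u]
          linear_combination ((1 + ε * (W s * Real.sin (k * t) * κ s)) ^ 2 +
            (ε * (W' s * Real.sin (k * t))) ^ 2) * harc
        rw [h1]
        congr 1
        -- The vertical component starts at `-ω ξ₁`, whereas `c₀ = ω ξ₁`; only its square matters.
        rw [← neg_sq (c₀ s t + ε * c₁ s t + ε ^ 2 * c₂ s t)]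
        congr 1
        simp only [c₀, c₁, c₂, us, u, ut, hη, support, hξ, xi₁]
        linear_combination (-(ε * (W s * (k * Real.cos (k * t)))) *
          (1 + ε * (W s * Real.sin (k * t) * κ s)) -
          ω * ε ^ 2 * (W' s * Real.sin (k * t)) * (W s * Real.sin (k * t))) * harc
      · simp only [m₀, m₁, m₂, m₃, m₄, L]
        ring
    all_goals unfold Function.uncurry; fun_prop
  rw [henergy, iteratedDeriv_two_integral_sqrt_add (f := f) (g := us) (c₀ := c₀) (c₁ := c₁)
    (c₂ := c₂) (m₀ := m₀) (m₁ := m₁) (m₂ := m₂) (m₃ := m₃) (m₄ := m₄)]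
  · congr 1; ext s
    -- The coefficient of `sin · cos` is supplied by hand, since it leaves no trace in the integral.
    -- That of `cos²` is `k² (W² - ω² ξ₁²) / W = k² / W`, and that of `sin²` is `variationCoeff`.
    rw [← integral_trigonometric_form hk hkh _ (2 * k * (ω * ξ s * κ s * W s + ω * η s * W' s) +
      2 * ω * ξ s * κ s * W s * k - 2 * k * ω * ξ s *
        (κ s * W s + ω * ξ s * (ω * ξ s * κ s * W s + ω * η s * W' s)) / W s ^ 2)]
    congr 1; ext t
    have hsq : √(1 + c₀ s t ^ 2) = W s := by
      simp only [c₀, hW, helicoidalDensity, hξ]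
      ring_nf
    have hW2 : W s ^ 2 = 1 + ω ^ 2 * ξ s ^ 2 := helicoidalDensity_sq ω x y s
    have hWs := hWne s
    rw [hsq]
    simp only [f, us, c₀, c₁, c₂, m₂, r₁, u, ut, L, variationCoeff, ← hκ, ← hξ, ← hη, ← hW, ← hW']
    field_simp
    linear_combination (32 * k ^ 2 * Real.cos (k * t) ^ 2 * W s ^ 2) * hW2
  all_goals first
    | exact hα.length_pos.le
    | linarith
    | (simp only [f, us, c₀, c₁, c₂, m₀, m₁, m₂, m₃, m₄, r₁, u, ut, L]; unfold Function.uncurry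
       fun_prop)

/-! ### Integration by parts along the profile. -/

/-- Integration by parts for `variationCoeff` on a surface in equilibrium. -/
theorem exists_primitive_variationCoeff {a Λ₀ ω : ℝ}
    (heq : IsEquilibrium a Λ₀ (helicoidal ω x y)) :
    ∃ T : ℝ → ℝ, (∀ s, T (s + ℓ) = T s) ∧ ∀ s, HasDerivAt T
      (variationCoeff a Λ₀ ω x y s + (4 * meanCurvature (helicoidal ω x y) s 0 ^ 2 *
        helicoidalDensity ω x y s + a * support x y s)) s := by
  -- The first summand accounts for the pure area terms, the second, `ω² η ξ · 2H`, for the terms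
  -- linear in `H`, and the third for the remaining terms with `a`.
  refine ⟨fun s => ω ^ 2 * (xi₁ x y s * helicoidalDensity ω x y s -
      xi₁ x y s / helicoidalDensity ω x y s) +
    ω ^ 2 * (support x y s * xi₁ x y s *
      (Λ₀ - a / 2 * (xi₁ x y s ^ 2 + support x y s ^ 2))) +
    a / 4 * (support x y s * xi₁ x y s * helicoidalDensity ω x y s ^ 2), fun s => ?_, fun s => ?_⟩
  · simp only [hα.xi₁_periodic, hα.support_periodic, hα.helicoidalDensity_periodic]
  have hW := (helicoidalDensity_pos ω x y s).ne'
  have dξ := hα.hasDerivAt_xi₁ s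
  have dη := hα.hasDerivAt_support s
  have dW := hα.hasDerivAt_helicoidalDensity ω s
  refine ((((dξ.mul dW).sub (dξ.div dW hW)).const_mul (ω ^ 2)).add
    ((((dη.mul dξ).mul ((((dξ.pow 2).add (dη.pow 2)).const_mul (a / 2)).const_sub Λ₀))).const_mul
      (ω ^ 2)) |>.add ((((dη.mul dξ).mul (dW.pow 2))).const_mul (a / 4))).congr_deriv ?_
  have hH : 2 * meanCurvature (helicoidal ω x y) s 0 =
      Λ₀ - a / 2 * (xi₁ x y s ^ 2 + support x y s ^ 2) := by
    rw [heq, hα.xi₁_sq_add_support_sq, helicoidal_eq_twisted, twisted, axisDistSq_rotVec]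
  have hH' := hα.two_mul_meanCurvature_helicoidal ω s 0
  have hsq := helicoidalDensity_sq ω x y s
  have hW' : helicoidalDensityDeriv ω x y s * helicoidalDensity ω x y s =
      ω ^ 2 * xi₁ x y s * (1 - signedCurvature x y s * support x y s) :=
    div_mul_cancel₀ _ hW
  simp only [variationCoeff, Pi.pow_apply, Pi.mul_apply, Pi.add_apply, Nat.cast_ofNat,
    Nat.add_one_sub_one, pow_one]
  have h4 : 4 * meanCurvature (helicoidal ω x y) s 0 ^ 2 =
      (2 * meanCurvature (helicoidal ω x y) s 0) ^ 2 := by ring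
  rw [h4]
  -- What remains is an algebraic identity in `K = 2H`, `κ`, `ξ`, `η`, `W`, `V = W'`, modulo the
  -- relations just collected.
  generalize hK : 2 * meanCurvature (helicoidal ω x y) s 0 = K at *
  generalize signedCurvature x y s = κ at *
  generalize xi₁ x y s = ξ at *
  generalize support x y s = η at *
  generalize helicoidalDensity ω x y s = W at *
  generalize helicoidalDensityDeriv ω x y s = V at *
  -- For given `V`, the curvature `κ` cancels from the area part by `W² = 1 + ω² ξ²`.
  have harea : ((κ * W) ^ 2 + V ^ 2 + (ω * ξ * κ * W + ω * η * V) ^ 2 + 2 * ω ^ 2 * ξ * W * V) / W -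
      (κ * W + ω * ξ * (ω * ξ * κ * W + ω * η * V)) ^ 2 / W ^ 3 =
      V ^ 2 * (W ^ 2 + ω ^ 2 * η ^ 2) / W ^ 3 + 2 * ω ^ 2 * ξ * V := by
    have hc : κ * W + ω * ξ * (ω * ξ * κ * W + ω * η * V) = κ * W ^ 3 + ω ^ 2 * ξ * η * V := by
      linear_combination -(κ * W) * hsq
    rw [hc]
    field_simp
    linear_combination (-(κ ^ 2 * W ^ 4) + ω ^ 2 * η ^ 2 * V ^ 2) * hsq
  -- This uses only the curvature formula for `K`, not the equilibrium equation.
  have hcurv : V ^ 2 * (W ^ 2 + ω ^ 2 * η ^ 2) / W ^ 3 + 2 * ω ^ 2 * ξ * V + K * κ * W ^ 2 +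
      K ^ 2 * W - ω ^ 2 * K * (κ * ξ ^ 2 + η * (1 - κ * η)) =
      ω ^ 2 * ((1 - κ * η) * W + ξ * V - ((1 - κ * η) * W - ξ * V) / W ^ 2) := by
    have hV : V = ω ^ 2 * ξ * (1 - κ * η) / W := eq_div_of_mul_eq hW hW'
    have hKN : K = (-κ * (1 + ω ^ 2 * (ξ ^ 2 + η ^ 2)) + ω ^ 2 * η) / W ^ 3 :=
      eq_div_of_mul_eq (pow_ne_zero 3 hW) hH'
    generalize hU : ω ^ 2 * ξ * (1 - κ * η) = U at *
    generalize hN : -κ * (1 + ω ^ 2 * (ξ ^ 2 + η ^ 2)) + ω ^ 2 * η = N at *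
    -- Both sides are brought over `W ^ 5` with numerators written in powers of `W ^ 2`, so that
    -- substituting `1 + ω² ξ²` leaves a polynomial identity.
    have hl : V ^ 2 * (W ^ 2 + ω ^ 2 * η ^ 2) / W ^ 3 + 2 * ω ^ 2 * ξ * V + K * κ * W ^ 2 +
        K ^ 2 * W - ω ^ 2 * K * (κ * ξ ^ 2 + η * (1 - κ * η)) =
        (U ^ 2 * (W ^ 2 + ω ^ 2 * η ^ 2) + 2 * ω ^ 2 * ξ * U * (W ^ 2) ^ 2 +
          N * κ * (W ^ 2) ^ 2 + N ^ 2 -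
          ω ^ 2 * N * (κ * ξ ^ 2 + η * (1 - κ * η)) * W ^ 2) / W ^ 5 := by
      rw [hV, hKN]
      field_simp
    have hr : ω ^ 2 * ((1 - κ * η) * W + ξ * V - ((1 - κ * η) * W - ξ * V) / W ^ 2) =
        ω ^ 2 * ((1 - κ * η) * (W ^ 2) ^ 3 + ξ * U * (W ^ 2) ^ 2 -
          ((1 - κ * η) * (W ^ 2) ^ 2 - ξ * U * W ^ 2)) / W ^ 5 := by
      rw [hV]
      field_simp
    rw [hl, hr, hsq, ← hU, ← hN]
    congr 1
    ring
  rw [harea]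
  have hΛ : Λ₀ / 2 - a / 8 * (ξ ^ 2 + η ^ 2) = K / 2 + a / 8 * (ξ ^ 2 + η ^ 2) := by
    rw [hH]; ring
  rw [hΛ, ← hH]
  linear_combination (-1 : ℝ) * hcurv + (a * η) * hsq

/-- The second variation of the energy along `sineVariation`, after integration by parts. -/
theorem iteratedDeriv_energy_sineVariation_eq {a Λ₀ ω h k : ℝ} (hh : 0 < h) (hk : k ≠ 0)
    (hkh : k * (h / 2) = Real.pi) (heq : IsEquilibrium a Λ₀ (helicoidal ω x y)) :
    iteratedDeriv 2 (fun ε => energy a Λ₀ ℓ h (sineVariation k ω x y ε)) 0 =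
      h / 2 * (k ^ 2 * (∫ s in (0 : ℝ)..ℓ, 1 / helicoidalDensity ω x y s) -
        2 * ((∫ s in (0 : ℝ)..ℓ, 2 * meanCurvature (helicoidal ω x y) s 0 ^ 2 *
          helicoidalDensity ω x y s) + a * enclosedArea x y ℓ)) := by
  obtain ⟨T, hper, hT⟩ := hα.exists_primitive_variationCoeff heq
  have cκ := hα.continuous_signedCurvature
  have cξ := hα.continuous_xi₁
  have cη := hα.continuous_support
  have cW := (hα.contDiff_helicoidalDensity ω).continuous
  have cW' := hα.continuous_helicoidalDensityDeriv ω
  have hWne : ∀ s, helicoidalDensity ω x y s ≠ 0 := fun s => (helicoidalDensity_pos ω x y s).ne'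
  have cinv : Continuous fun s => 1 / helicoidalDensity ω x y s := continuous_const.div cW hWne
  -- Equilibrium makes `H` a polynomial in `ξ₁` and `η`, so continuity is immediate.
  have cH : Continuous fun s => meanCurvature (helicoidal ω x y) s 0 := by
    have h1 : (fun s => meanCurvature (helicoidal ω x y) s 0) = fun s =>
        (Λ₀ - a / 2 * (xi₁ x y s ^ 2 + support x y s ^ 2)) / 2 := by
      ext s
      have := heq s 0
      rw [helicoidal_eq_twisted, twisted, axisDistSq_rotVec, ← hα.xi₁_sq_add_support_sq] at this
      rw [helicoidal_eq_twisted]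
      linarith
    rw [h1]
    fun_prop
  have cv : Continuous (variationCoeff a Λ₀ ω x y) := by
    unfold variationCoeff
    refine ((Continuous.div (by fun_prop) cW hWne).sub
      (Continuous.div (by fun_prop) (cW.pow 3) fun s => pow_ne_zero 3 (hWne s))).add (by fun_prop)
  have hint : (∫ s in (0 : ℝ)..ℓ, variationCoeff a Λ₀ ω x y s) =
      -2 * ((∫ s in (0 : ℝ)..ℓ, 2 * meanCurvature (helicoidal ω x y) s 0 ^ 2 *
          helicoidalDensity ω x y s) + a * enclosedArea x y ℓ) := by
    have h0 := intervalIntegral.integral_eq_sub_of_hasDerivAt (a := 0) (b := ℓ) (fun s _ => hT s)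
      (Continuous.intervalIntegrable (by fun_prop) _ _)
    have hper0 : T ℓ = T 0 := by simpa using hper 0
    rw [hper0, sub_self, intervalIntegral.integral_add (cv.intervalIntegrable _ _)
      (Continuous.intervalIntegrable (by fun_prop) _ _), intervalIntegral.integral_add
      (Continuous.intervalIntegrable (by fun_prop) _ _)
      (Continuous.intervalIntegrable (by fun_prop) _ _), intervalIntegral.integral_const_mul] at h0
    have h2 : (∫ s in (0 : ℝ)..ℓ, 4 * meanCurvature (helicoidal ω x y) s 0 ^ 2 *
        helicoidalDensity ω x y s) = 2 * ∫ s in (0 : ℝ)..ℓ,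
        2 * meanCurvature (helicoidal ω x y) s 0 ^ 2 * helicoidalDensity ω x y s := by
      rw [← intervalIntegral.integral_const_mul]
      congr 1; ext s; ring
    have h3 : enclosedArea x y ℓ = 1 / 2 * ∫ s in (0 : ℝ)..ℓ, support x y s := rfl
    rw [h3]
    linear_combination h0 - h2
  rw [hα.iteratedDeriv_energy_sineVariation hh hk hkh, intervalIntegral.integral_const_mul,
    intervalIntegral.integral_add (Continuous.intervalIntegrable (by fun_prop) _ _)
      (cv.intervalIntegrable _ _), intervalIntegral.integral_const_mul, hint]
  ring

/-! ### The two bounds. -/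

theorem areaBound_of_isStable {a Λ₀ ω h : ℝ} (hh : 0 < h)
    (heq : IsEquilibrium a Λ₀ (helicoidal ω x y))
    (hstable : IsStable a Λ₀ ℓ h (helicoidal ω x y)) : AreaBound a ω ℓ h x y := by
  -- The lower mode `cos (π t / h)` also vanishes at the ends but has nonzero mean; `sin (2π t / h)`
  -- is odd, hence admissible.
  have hk : 2 * Real.pi / h ≠ 0 := by positivity
  have hkh : 2 * Real.pi / h * (h / 2) = Real.pi := by field_simp
  have hzero : surfaceIntegral ℓ h (helicoidal ω x y)
      (normalComponent (helicoidal ω x y) (sineVariation (2 * Real.pi / h) ω x y)) = 0 := by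
    simp only [surfaceIntegral, hα.normalComponent_sineVariation, hα.areaDensity_helicoidal,
      intervalIntegral.integral_mul_const]
    have : ∫ t in (-(h / 2))..(h / 2), Real.sin (2 * Real.pi / h * t) = 0 := by
      rw [intervalIntegral.integral_comp_mul_left _ hk]
      simp [hkh]
    simp [this]
  have h0 := hstable _ (hα.isVariation_sineVariation hkh ω) hzero
  rw [hα.iteratedDeriv_energy_sineVariation_eq hh hk hkh heq] at h0
  have h1 := nonneg_of_mul_nonneg_right h0 (half_pos hh)
  have h2 : (2 * Real.pi / h) ^ 2 = 2 * (2 * Real.pi ^ 2 / h ^ 2) := by ring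
  rw [h2] at h1
  unfold AreaBound
  simp only [helicoidalDensity] at h1
  linarith

/-- All slices are rotated copies of the profile, so both surface integrals are `h` times integrals
over `α`, and the bounds differ by the factor `h > 0`. Equilibrium serves only to show that `H` does
not depend on `t`, through `R²`. -/
theorem areaBound_iff_volumeBound {a Λ₀ ω h : ℝ} (hh : 0 < h)
    (heq : IsEquilibrium a Λ₀ (helicoidal ω x y)) :
    AreaBound a ω ℓ h x y ↔ VolumeBound a ω ℓ h x y := by
  have hH : ∀ s t, meanCurvature (helicoidal ω x y) s t =
      meanCurvature (helicoidal ω x y) s 0 := fun s t => by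
    have h1 := heq s t
    have h2 := heq s 0
    rw [helicoidal_eq_twisted, twisted, axisDistSq_rotVec] at h1 h2
    rw [helicoidal_eq_twisted]
    linarith
  have hSI : surfaceIntegral ℓ h (helicoidal ω x y)
      (fun s t => 2 * meanCurvature (helicoidal ω x y) s t ^ 2) =
      h * ∫ s in (0 : ℝ)..ℓ,
        2 * meanCurvature (helicoidal ω x y) s 0 ^ 2 * √(1 + ω ^ 2 * xi₁ x y s ^ 2) := by
    simp only [surfaceIntegral, hH, hα.areaDensity_helicoidal, intervalIntegral.integral_const,
      smul_eq_mul, helicoidalDensity]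
    rw [← intervalIntegral.integral_const_mul]
    congr 1; ext s; ring
  have hV : volume ℓ h (helicoidal ω x y) = h * enclosedArea x y ℓ := by
    have h1 : ∀ s t, fieldW₀ (helicoidal ω x y s t) ⬝ᵥ
        (dS (helicoidal ω x y) s t ⨯₃ dT (helicoidal ω x y) s t) =
        1 / 2 * (x s * deriv y s - y s * deriv x s) := fun s t => by
      rw [hα.cross_helicoidal, helicoidal_eq_twisted, twisted, fieldW₀_rotVec, rotVec_dot]
      ring
    simp only [volume, surfaceIntegral, dotProduct_unitNormal_mul_areaDensity, h1,
      intervalIntegral.integral_const, smul_eq_mul, intervalIntegral.integral_const_mul,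
      enclosedArea]
    ring
  unfold AreaBound VolumeBound
  rw [hSI, hV, ge_iff_le, ge_iff_le, ← mul_le_mul_iff_right₀ hh]
  generalize (∫ s in (0 : ℝ)..ℓ, 1 / √(1 + ω ^ 2 * xi₁ x y s ^ 2)) = I
  have h1 : h * (2 * Real.pi ^ 2 / h ^ 2 * I) = 2 * Real.pi ^ 2 / h * I := by field_simp
  rw [h1, mul_add, mul_left_comm h a]

end IsClosedCurve

end HelicoidalDrop

end

theorem mainTheorem5 (a Λ₀ ω ℓ h : ℝ) (x y : ℝ → ℝ) (hh : 0 < h)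
    (hα : IsClosedCurve x y ℓ)
    (heq : IsEquilibrium a Λ₀ (helicoidal ω x y)) :
    (IsStable a Λ₀ ℓ h (helicoidal ω x y) → AreaBound a ω ℓ h x y) ∧
    (AreaBound a ω ℓ h x y ↔ VolumeBound a ω ℓ h x y) :=
  ⟨hα.areaBound_of_isStable hh heq, hα.areaBound_iff_volumeBound hh heq⟩
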